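/- Let $J\subseteq\mathbb{R}$ be an interval and let $f:J\to\mathbb{R}$ be continuous. For a complex Hilbert space $\mathcal H$, let $sp(J)$ denote the set of all self-adjoint bounded operators on $\mathcal H$ whose spectra are contained in $J$; for $X\in sp(J)$ let $f(X)$ be given by the continuous functional calculus, and write $X\le Y$ if $Y-X$ is a positive operator. If $\dim\mathcal H=n<\infty$, identify the bounded operators on $\mathcal H$ with the algebra $\mathbb{M}_n$ of complex $n\times n$ matrices. Call $f$ operator convex on $\mathcal H$ if $$f\left(\frac{X+Y}{2}\right)\le\frac{f(X)+f(Y)}{2}\qquad\text{for all } X,Y\in sp(J),$$ and call $f$ operator convex if it is operator convex on every complex Hilbert space $\mathcal H$. A finite family $\{\Phi_i\}_{i=1}^m$ of positive linear maps on $\mathbb{M}_n$ is called unital if $\sum_{i=1}^m\Phi_i(I)=I$. Then $f$ is operator convex if and only if $$f\left(\sum_{i=1}^m\Phi_i(X_i)\right)\le\sum_{i=1}^m\Phi_i(f(X_i))\tag{1}$$ for all $n,m$, all $X_1,\dots,X_m\in\mathbb{M}_n$ in $sp(J)$, and every unital family $\{\Phi_i\}_{i=1}^m$ of positive linear maps on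 $\mathbb{M}_n$. Moreover, for each infinite-dimensional complex Hilbert space $\mathcal H$, $f$ is operator convex on $\mathcal H$ if and only if (1) holds for all such $n$, $m$, $X_i$ and $\Phi_i$. -/

import Mathlib

open scoped MatrixOrder ComplexOrder

universe u

/-- `sp A J` is the set of all self-adjoint elements of `A` whose spectra are contained in `J`.
It is used for `A = B(H)` and for the algebra of complex `n × n` matrices. -/
def sp (A : Type*) [Ring A] [StarRing A] [Algebra ℝ A] (J : Set ℝ) : Set A :=
  {X | IsSelfAdjoint X ∧ spectrum ℝ X ⊆ J}

/-- `f((X + Y) / 2) ≤ (f(X) + f(Y)) / 2` for all self-adjoint operators `X`, `Y` on the Hilbert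
space `H` with spectra in `J`, in the order given by positivity of operators. -/
def IsOperatorConvexOnSpace (H : Type u) [NormedAddCommGroup H] [InnerProductSpace ℂ H]
    [CompleteSpace H] (J : Set ℝ) (f : ℝ → ℝ) : Prop :=
  ∀ X ∈ sp (H →L[ℂ] H) J, ∀ Y ∈ sp (H →L[ℂ] H) J,
    cfc f ((1 / 2 : ℝ) • (X + Y)) ≤ (1 / 2 : ℝ) • (cfc f X + cfc f Y)

/-- `f` is operator convex on `J`: the midpoint inequality holds on every complex Hilbert space. -/
def IsOperatorConvex (J : Set ℝ) (f : ℝ → ℝ) : Prop :=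
  ∀ (H : Type u) [NormedAddCommGroup H] [InnerProductSpace ℂ H] [CompleteSpace H],
    IsOperatorConvexOnSpace H J f

/-- A finite family of positive linear maps on the complex `n × n` matrices is unital if
`∑ i, Φ i I = I`. -/
def IsUnitalFamily {n m : ℕ}
    (Φ : Fin m → (Matrix (Fin n) (Fin n) ℂ →ₚ[ℂ] Matrix (Fin n) (Fin n) ℂ)) : Prop :=
  ∑ i, Φ i 1 = 1

/-- The Choi-Davis-Jensen inequality `f(∑ Φ_i(X_i)) ≤ ∑ Φ_i(f(X_i))`, for matrices of every
size, all families `X_i` in `sp(J)` and all unital families of positive linear maps. -/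
def ChoiDavisJensen (J : Set ℝ) (f : ℝ → ℝ) : Prop :=
  ∀ (n m : ℕ) (Φ : Fin m → (Matrix (Fin n) (Fin n) ℂ →ₚ[ℂ] Matrix (Fin n) (Fin n) ℂ)),
    IsUnitalFamily Φ →
    ∀ X : Fin m → Matrix (Fin n) (Fin n) ℂ, (∀ i, X i ∈ sp (Matrix (Fin n) (Fin n) ℂ) J) →
      cfc f (∑ i, Φ i (X i)) ≤ ∑ i, Φ i (cfc f (X i))

/-! ### Compressions, functional calculus and Jensen's inequality for isometries. -/

section Operators

open ContinuousLinearMap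
open Polynomial (aeval aeval_monomial)
open scoped InnerProduct Polynomial

variable {H K : Type*} [NormedAddCommGroup H] [InnerProductSpace ℂ H] [CompleteSpace H]
  [NormedAddCommGroup K] [InnerProductSpace ℂ K] [CompleteSpace K]

/-! Convexity to (1): spectral resolutions `X i = ∑ t P` turn both sides of (1) into sums weighted
by the positive matrices `Φ i (P i k)`, whose total is `1`. A Naimark dilation realises these
weights as the compression of orthogonal projections along an isometry into `H` (`cfc_sum_smul_le`),
and Jensen for isometries (`cfc_adjoint_conj_le`) follows from the midpoint inequality for `X` and
its conjugate by a reflection. Only finitely many orthonormal vectors of `H` are used, so any one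
infinite-dimensional space suffices.

Converse: two copies of half the identity map give matrix convexity. On general `H`, replace `f` by
a polynomial and compress to a finite-dimensional space of Krylov vectors of `v`; the quadratic
forms at `v` change arbitrarily little. -/

lemma mem_sp_Icc_iff {c d : ℝ} {X : H →L[ℂ] H} :
    X ∈ sp (H →L[ℂ] H) (Set.Icc c d) ↔
      IsSelfAdjoint X ∧ algebraMap ℝ (H →L[ℂ] H) c ≤ X ∧ X ≤ algebraMap ℝ (H →L[ℂ] H) d := by
  refine and_congr_right fun hX => ?_
  rw [algebraMap_le_iff_le_spectrum hX, le_algebraMap_iff_spectrum_le hX]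
  exact ⟨fun h => ⟨fun x hx => (h hx).1, fun x hx => (h hx).2⟩, fun h x hx => ⟨h.1 x hx, h.2 x hx⟩⟩

lemma sp_mono {A : Type*} [Ring A] [StarRing A] [Algebra ℝ A] {I J : Set ℝ} (h : I ⊆ J) :
    sp A I ⊆ sp A J :=
  fun _ hX => ⟨hX.1, hX.2.trans h⟩

/-- Compactness of the spectrum gives a compact interval, where Weierstrass approximation applies
even if `J` is not closed. -/
lemma exists_mem_sp_Icc [Nontrivial H] {J : Set ℝ} {X : H →L[ℂ] H}
    (hX : X ∈ sp (H →L[ℂ] H) J) :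
    ∃ c ∈ J, ∃ d ∈ J, X ∈ sp (H →L[ℂ] H) (Set.Icc c d) := by
  have hc : IsCompact (spectrum ℝ X) := isCompact_iff_compactSpace.mpr inferInstance
  have hne : (spectrum ℝ X).Nonempty := ContinuousFunctionalCalculus.spectrum_nonempty X hX.1
  obtain ⟨c, hc1, hc2⟩ := hc.exists_isLeast hne
  obtain ⟨d, hd1, hd2⟩ := hc.exists_isGreatest hne
  exact ⟨c, hX.2 hc1, d, hX.2 hd1, hX.1, fun x hx => ⟨hc2 hx, hd2 hx⟩⟩

lemma adjoint_conj_mono {X Y : H →L[ℂ] H} (h : X ≤ Y) (V : K →L[ℂ] H) :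
    V† ∘L X ∘L V ≤ V† ∘L Y ∘L V := by
  rw [le_def] at h ⊢
  simpa only [sub_comp, comp_sub] using h.adjoint_conj V

lemma adjoint_conj_algebraMap {V : K →L[ℂ] H} (hV : V† ∘L V = 1) (c : ℝ) :
    V† ∘L (algebraMap ℝ (H →L[ℂ] H) c) ∘L V = algebraMap ℝ (K →L[ℂ] K) c := by
  ext x
  have := congr($hV x)
  simp only [comp_apply, one_apply_eq_self] at this
  simp [Algebra.algebraMap_eq_smul_one, this]

lemma adjoint_conj_mem_sp_Icc {V : K →L[ℂ] H} (hV : V† ∘L V = 1) {c d : ℝ} {X : H →L[ℂ] H}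
    (hX : X ∈ sp (H →L[ℂ] H) (Set.Icc c d)) :
    V† ∘L X ∘L V ∈ sp (K →L[ℂ] K) (Set.Icc c d) := by
  rw [mem_sp_Icc_iff] at hX ⊢
  refine ⟨hX.1.adjoint_conj V, ?_, ?_⟩
  · simpa only [adjoint_conj_algebraMap hV] using adjoint_conj_mono hX.2.1 V
  · simpa only [adjoint_conj_algebraMap hV] using adjoint_conj_mono hX.2.2 V

lemma midpoint_mem_sp_Icc {c d : ℝ} {X Y : H →L[ℂ] H}
    (hX : X ∈ sp (H →L[ℂ] H) (Set.Icc c d)) (hY : Y ∈ sp (H →L[ℂ] H) (Set.Icc c d)) :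
    (1 / 2 : ℝ) • (X + Y) ∈ sp (H →L[ℂ] H) (Set.Icc c d) := by
  rw [mem_sp_Icc_iff] at hX hY ⊢
  have key (r : ℝ) : algebraMap ℝ (H →L[ℂ] H) r =
      (1 / 2 : ℝ) • (algebraMap ℝ (H →L[ℂ] H) r + algebraMap ℝ (H →L[ℂ] H) r) := by
    rw [← two_smul ℝ, smul_smul]; norm_num
  have hmono {A B : H →L[ℂ] H} (hAB : A ≤ B) : (1 / 2 : ℝ) • A ≤ (1 / 2 : ℝ) • B :=
    smul_le_smul_of_nonneg_left hAB (by norm_num)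
  refine ⟨(IsSelfAdjoint.all (1 / 2 : ℝ)).smul (hX.1.add hY.1), ?_, ?_⟩
  · exact (key c).le.trans (hmono (add_le_add hX.2.1 hY.2.1))
  · exact (hmono (add_le_add hX.2.2 hY.2.2)).trans (key d).ge

lemma norm_cfc_sub_aeval_le {c d ε : ℝ} (hε : 0 ≤ ε) {f : ℝ → ℝ} (hf : ContinuousOn f (Set.Icc c d))
    {p : ℝ[X]} (hp : ∀ x ∈ Set.Icc c d, |p.eval x - f x| < ε) {X : H →L[ℂ] H}
    (hX : X ∈ sp (H →L[ℂ] H) (Set.Icc c d)) : ‖cfc f X - aeval X p‖ ≤ ε := by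
  rw [← cfc_polynomial p X hX.1, ← cfc_sub f _ X (hf.mono hX.2) (by fun_prop)]
  refine norm_cfc_le hε fun x hx => ?_
  rw [norm_sub_rev]
  exact (hp x (hX.2 hx)).le

lemma aeval_comp_of_comp_eq {H K : Type*} [NormedAddCommGroup H] [InnerProductSpace ℂ H]
    [NormedAddCommGroup K] [InnerProductSpace ℂ K] {T : H →L[ℂ] H} {S : K →L[ℂ] K} {V : K →L[ℂ] H}
    (h : T ∘L V = V ∘L S) (p : ℝ[X]) : aeval T p ∘L V = V ∘L aeval S p := by
  induction p using Polynomial.induction_on' with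
  | add p q hp hq => simp only [map_add, add_comp, comp_add, hp, hq]
  | monomial n a =>
    have hpow : (T ^ n) ∘L V = V ∘L (S ^ n) := by
      induction n with
      | zero => rfl
      | succ n ih =>
        rw [pow_succ, pow_succ, mul_def, mul_def, comp_assoc, h, ← comp_assoc, ih, comp_assoc]
    ext x
    have := congr($hpow x)
    simp only [comp_apply] at this
    simp [aeval_monomial, Algebra.algebraMap_eq_smul_one, this]

/-- The continuous functional calculus respects intertwining relations. -/
lemma cfc_comp_of_comp_eq {c d : ℝ} {f : ℝ → ℝ} (hf : ContinuousOn f (Set.Icc c d))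
    {T : H →L[ℂ] H} {S : K →L[ℂ] K} {V : K →L[ℂ] H}
    (hT : T ∈ sp (H →L[ℂ] H) (Set.Icc c d)) (hS : S ∈ sp (K →L[ℂ] K) (Set.Icc c d))
    (h : T ∘L V = V ∘L S) : cfc f T ∘L V = V ∘L cfc f S := by
  rw [← sub_eq_zero, ← norm_le_zero_iff]
  refine le_of_forall_pos_le_add fun ε hε => ?_
  obtain ⟨p, hp⟩ := exists_polynomial_near_of_continuousOn c d f hf (ε / (2 * (‖V‖ + 1)))
    (by positivity)
  have h1 := norm_cfc_sub_aeval_le (by positivity) hf hp hT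
  have h2 := norm_cfc_sub_aeval_le (by positivity) hf hp hS
  have e : cfc f T ∘L V - V ∘L cfc f S =
      (cfc f T - aeval T p) ∘L V - V ∘L (cfc f S - aeval S p) := by
    rw [sub_comp, comp_sub, aeval_comp_of_comp_eq h]; abel
  rw [e, zero_add]
  calc _ ≤ ‖cfc f T - aeval T p‖ * ‖V‖ + ‖V‖ * ‖cfc f S - aeval S p‖ :=
        (norm_sub_le _ _).trans (add_le_add (opNorm_comp_le _ _) (opNorm_comp_le _ _))
    _ ≤ ε / (2 * (‖V‖ + 1)) * (‖V‖ + 1) + (‖V‖ + 1) * (ε / (2 * (‖V‖ + 1))) := by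
        gcongr <;> linarith
    _ = ε := by field_simp; ring

/-- Jensen's inequality for compressions along an isometry. -/
lemma IsOperatorConvexOnSpace.cfc_adjoint_conj_le {H : Type u} [NormedAddCommGroup H]
    [InnerProductSpace ℂ H] [CompleteSpace H] {J : Set ℝ} {f : ℝ → ℝ}
    (h : IsOperatorConvexOnSpace H J f) {c d : ℝ} (hcd : Set.Icc c d ⊆ J)
    (hf : ContinuousOn f (Set.Icc c d)) {X : H →L[ℂ] H}
    (hX : X ∈ sp (H →L[ℂ] H) (Set.Icc c d)) {W : K →L[ℂ] H} (hW : W† ∘L W = 1) :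
    cfc f (W† ∘L X ∘L W) ≤ W† ∘L cfc f X ∘L W := by
  have hWW (x : K) : (W†) (W x) = x := congr($hW x)
  -- `U` is the reflection fixing the range of `W`. Averaging `X` with `U† X U` removes the
  -- off-diagonal blocks, so the average maps that range into itself (`hZW`).
  set U : H →L[ℂ] H := (2 : ℝ) • (W ∘L W†) - 1 with hU
  have hUadj : U† = U := by
    rw [← star_eq_adjoint, hU, star_sub, star_smul, star_one, star_eq_adjoint, adjoint_comp,
      adjoint_adjoint]
    simp
  have hUx (x : H) : U x = (2 : ℝ) • W ((W†) x) - x := by simp [hU]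
  have hUW : U ∘L W = W := by
    ext x
    simp only [comp_apply, hUx, hWW]
    rw [two_smul]; abel
  have hWU : W† ∘L U = W† := by
    rw [← hUadj, ← adjoint_comp, hUW]
  have hUU : U† ∘L U = 1 := by
    ext x
    rw [hUadj]
    simp only [comp_apply, hUx, map_sub, map_smul_of_tower, hWW, one_apply_eq_self]
    simp only [two_smul]
    abel
  have hUU' : U ∘L U = 1 := by rwa [hUadj] at hUU
  set Y : H →L[ℂ] H := U† ∘L X ∘L U with hY
  have hYmem : Y ∈ sp (H →L[ℂ] H) (Set.Icc c d) := adjoint_conj_mem_sp_Icc hUU hX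
  have hfY : cfc f Y = U ∘L cfc f X ∘L U := by
    have h1 : X ∘L U = U ∘L Y := by
      rw [hY, hUadj, ← comp_assoc, hUU']; rfl
    rw [cfc_comp_of_comp_eq hf hX hYmem h1, ← comp_assoc, hUU']; rfl
  have hmid := h X (sp_mono hcd hX) Y (sp_mono hcd hYmem)
  have hZ := midpoint_mem_sp_Icc hX hYmem
  have hS := adjoint_conj_mem_sp_Icc hW hX
  have hZW : ((1 / 2 : ℝ) • (X + Y)) ∘L W = W ∘L (W† ∘L X ∘L W) := by
    have e : Y ∘L W = U ∘L X ∘L W := by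
      rw [hY, hUadj, comp_assoc, comp_assoc, hUW]
    ext x
    have e' : Y (W x) = U (X (W x)) := congr($e x)
    simp only [comp_apply, smul_apply, add_apply, e', hUx]
    rw [add_sub_cancel, smul_smul]
    norm_num
  have hfZ := cfc_comp_of_comp_eq hf hZ hS hZW
  have e1 : cfc f (W† ∘L X ∘L W) = W† ∘L cfc f ((1 / 2 : ℝ) • (X + Y)) ∘L W := by
    rw [hfZ]
    exact ContinuousLinearMap.ext fun x => (hWW _).symm
  have e2 : W† ∘L ((1 / 2 : ℝ) • (cfc f X + cfc f Y)) ∘L W = W† ∘L cfc f X ∘L W := by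
    have e : W† ∘L cfc f Y ∘L W = W† ∘L cfc f X ∘L W := by
      rw [hfY, comp_assoc, comp_assoc, hUW, ← comp_assoc, hWU]
    ext x
    have e' : (W†) (cfc f Y (W x)) = (W†) (cfc f X (W x)) := congr($e x)
    simp only [comp_apply, smul_apply, add_apply, map_smul_of_tower, map_add, e']
    rw [← two_smul ℝ, smul_smul]
    norm_num
  rw [e1, ← e2]
  exact adjoint_conj_mono hmid W

end Operators

/-! ### Naimark dilation of positive weights. -/

section OrthogonalRanges

open ContinuousLinearMap
open scoped InnerProduct

variable {ι : Type*} [Fintype ι] [DecidableEq ι] {E : Type*} [NormedAddCommGroup E]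
  [InnerProductSpace ℂ E] [CompleteSpace E]

/-- An operator acting as scalars on the ranges of isometries `W i` with orthogonal ranges
compresses to a linear combination of the operators `(B i)† (B i)`. -/
lemma adjoint_sum_conj_eq {H : Type*} [NormedAddCommGroup H] [InnerProductSpace ℂ H]
    [CompleteSpace H] {W : ι → E →L[ℂ] H}
    (hW : ∀ i j, (W i)† ∘L W j = if i = j then 1 else 0) (B : ι → E →L[ℂ] E)
    {T : H →L[ℂ] H} {t : ι → ℝ} (hT : ∀ i, T ∘L W i = t i • W i) :
    (∑ i, W i ∘L B i)† ∘L T ∘L (∑ i, W i ∘L B i) = ∑ i, t i • ((B i)† ∘L B i) := by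
  have h1 : T ∘L (∑ i, W i ∘L B i) = ∑ i, t i • (W i ∘L B i) := by
    rw [comp_finsetSum]
    refine Finset.sum_congr rfl fun i _ => ?_
    rw [← comp_assoc, hT, smul_comp]
  have h2 (i j : ι) : (W i ∘L B i)† ∘L (t j • (W j ∘L B j)) =
      if i = j then t j • ((B i)† ∘L B j) else 0 := by
    have hx (x : E) : ((W i)†) (W j x) = (if i = j then (1 : E →L[ℂ] E) else 0) x :=
      congr($(hW i j) x)
    ext x
    rw [adjoint_comp]
    simp only [comp_apply, smul_apply, map_smul_of_tower, hx]
    split_ifs <;> simp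
  rw [h1, map_sum, finsetSum_comp]
  simp only [comp_finsetSum, h2]
  simp

/-- Jensen's inequality for operator convex functions with positive operators as weights. -/
lemma IsOperatorConvexOnSpace.cfc_sum_smul_le {H : Type u} [NormedAddCommGroup H]
    [InnerProductSpace ℂ H] [CompleteSpace H] {J : Set ℝ} (hJ : J.OrdConnected) {f : ℝ → ℝ}
    (hf : ContinuousOn f J) (h : IsOperatorConvexOnSpace H J f) [Nonempty ι]
    {W : ι → E →L[ℂ] H} (hW : ∀ i j, (W i)† ∘L W j = if i = j then 1 else 0)
    {A : ι → E →L[ℂ] E} (hA : ∀ i, 0 ≤ A i) (hA1 : ∑ i, A i = 1) {t : ι → ℝ}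
    (ht : ∀ i, t i ∈ J) :
    cfc f (∑ i, t i • A i) ≤ ∑ i, f (t i) • A i := by
  choose B hB using fun i => CStarAlgebra.nonneg_iff_eq_star_mul_self.1 (hA i)
  have hAB : A = fun i => (B i)† ∘L B i := funext hB
  obtain ⟨i₀, -, hi₀⟩ := Finset.exists_min_image Finset.univ t Finset.univ_nonempty
  obtain ⟨i₁, -, hi₁⟩ := Finset.exists_max_image Finset.univ t Finset.univ_nonempty
  set a := t i₀
  set d := t i₁
  have hcd : Set.Icc a d ⊆ J := hJ.out (ht i₀) (ht i₁)
  have hmem (i : ι) : t i ∈ Set.Icc a d := ⟨hi₀ i (Finset.mem_univ i), hi₁ i (Finset.mem_univ i)⟩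
  set P : H →L[ℂ] H := ∑ i, W i ∘L (W i)† with hP
  have hPW (i : ι) : P ∘L W i = W i := by
    rw [hP, finsetSum_comp]
    have (j : ι) : (W j ∘L (W j)†) ∘L W i = if j = i then W j else 0 := by
      rw [comp_assoc, hW]
      split_ifs
      · rfl
      · exact comp_zero _
    simp [this]
  have hPsa : IsSelfAdjoint P := by
    rw [hP]
    exact isSelfAdjoint_sum _ fun i _ => (isPositive_self_comp_adjoint (W i)).isSelfAdjoint
  have hPP : P * P = P := by
    have : P ∘L (∑ i, W i ∘L (W i)†) = ∑ i, W i ∘L (W i)† := by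
      rw [comp_finsetSum]
      refine Finset.sum_congr rfl fun i _ => ?_
      rw [← comp_assoc, hPW]
    exact this
  have hQ : 0 ≤ 1 - P := by
    have : 1 - P = star (1 - P) * (1 - P) := by
      rw [star_sub, star_one, hPsa.star_eq, mul_sub, sub_mul, sub_mul, hPP]; simp
    rw [this]
    exact star_mul_self_nonneg _
  have hWnn (i : ι) : 0 ≤ W i ∘L (W i)† :=
    (nonneg_iff_isPositive _).2 (isPositive_self_comp_adjoint (W i))
  -- The value `a` off the ranges only keeps the spectrum in `[a, d]`; the compression does not see
  -- it.
  set X : H →L[ℂ] H := a • (1 - P) + ∑ i, t i • (W i ∘L (W i)†) with hX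
  have hXW (i : ι) : X ∘L W i = t i • W i := by
    have (j : ι) : (t j • (W j ∘L (W j)†)) ∘L W i = if j = i then t j • W j else 0 := by
      rw [smul_comp, comp_assoc, hW]
      split_ifs
      · rfl
      · rw [comp_zero, smul_zero]
    rw [hX, add_comp, smul_comp, sub_comp, hPW, finsetSum_comp]
    simp [this, one_def]
  have hXmem : X ∈ sp (H →L[ℂ] H) (Set.Icc a d) := by
    rw [mem_sp_Icc_iff]
    have key (r : ℝ) : algebraMap ℝ (H →L[ℂ] H) r =
        r • (1 - P) + ∑ i, r • (W i ∘L (W i)†) := by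
      rw [← Finset.smul_sum, ← hP, ← smul_add, sub_add_cancel, Algebra.algebraMap_eq_smul_one]
    refine ⟨?_, ?_, ?_⟩
    · refine ((IsSelfAdjoint.all a).smul hQ.isSelfAdjoint).add (isSelfAdjoint_sum _ fun i _ => ?_)
      exact (IsSelfAdjoint.all (t i)).smul (hWnn i).isSelfAdjoint
    · rw [key a, hX]
      exact add_le_add le_rfl (Finset.sum_le_sum fun i _ =>
        smul_le_smul_of_nonneg_right (hmem i).1 (hWnn i))
    · rw [key d, hX]
      exact add_le_add (smul_le_smul_of_nonneg_right (hmem i₁).1 hQ)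
        (Finset.sum_le_sum fun i _ => smul_le_smul_of_nonneg_right (hmem i).2 (hWnn i))
  have hfX (i : ι) : cfc f X ∘L W i = f (t i) • W i := by
    have hs : algebraMap ℝ (E →L[ℂ] E) (t i) ∈ sp (E →L[ℂ] E) (Set.Icc a d) := by
      rw [mem_sp_Icc_iff]
      exact ⟨.algebraMap _ (.all _), algebraMap_mono _ (hmem i).1, algebraMap_mono _ (hmem i).2⟩
    have e : X ∘L W i = W i ∘L algebraMap ℝ (E →L[ℂ] E) (t i) := by
      rw [hXW]; ext x; simp [Algebra.algebraMap_eq_smul_one]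
    rw [cfc_comp_of_comp_eq (hf.mono hcd) hXmem hs e, cfc_algebraMap]
    ext x; simp [Algebra.algebraMap_eq_smul_one]
  have hV : (∑ i, W i ∘L B i)† ∘L (∑ i, W i ∘L B i) = 1 := by
    have := adjoint_sum_conj_eq hW B (T := 1) (t := fun _ => 1) fun i => by simp [one_def]
    simp only [one_smul] at this
    rw [← hA1, hAB, ← this, one_def, id_comp]
  have := h.cfc_adjoint_conj_le hcd (hf.mono hcd) hXmem hV
  rw [adjoint_sum_conj_eq hW B hXW, adjoint_sum_conj_eq hW B hfX] at this
  simpa only [hAB] using this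

lemma exists_isometries_of_orthonormal {ι : Type*} [DecidableEq ι] {n : ℕ} {H : Type*}
    [NormedAddCommGroup H] [InnerProductSpace ℂ H] [CompleteSpace H] {e : ι × Fin n → H} (he : Orthonormal ℂ e) :
    ∃ W : ι → EuclideanSpace ℂ (Fin n) →L[ℂ] H,
      ∀ i j, (W i)† ∘L W j = if i = j then 1 else 0 := by
  -- `W i` sends the `k`-th standard basis vector to `e (i, k)`.
  refine ⟨fun i => ∑ k, (EuclideanSpace.proj (𝕜 := ℂ) k).smulRight (e (i, k)), fun i j => ?_⟩
  ext1 x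
  refine ext_inner_left ℂ fun y => ?_
  rw [comp_apply, adjoint_inner_right]
  rw [orthonormal_iff_ite] at he
  simp only [sum_apply, smulRight_apply, PiLp.proj_apply, sum_inner, inner_sum,
    inner_smul_left, inner_smul_right, he, Prod.mk.injEq]
  split_ifs with hij
  · simp [hij, PiLp.inner_apply, mul_comm]
  · simp [hij]

lemma exists_orthonormal_of_not_finiteDimensional {H : Type*} [NormedAddCommGroup H]
    [InnerProductSpace ℂ H] (hH : ¬ FiniteDimensional ℂ H) (κ : Type*) [Fintype κ] :
    ∃ e : κ → H, Orthonormal ℂ e := by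
  have hr : ((Fintype.card κ : ℕ) : Cardinal) ≤ Module.rank ℂ H := by
    refine (Cardinal.natCast_lt_aleph0.le).trans ?_
    rw [← not_lt]
    exact fun h => hH (Module.rank_lt_aleph0_iff.1 h)
  obtain ⟨s, hs, hli⟩ := exists_finset_linearIndependent_of_le_rank hr
  have hfr : Module.finrank ℂ (Submodule.span ℂ (s : Set H)) = Fintype.card κ := by
    rw [finrank_span_finset_eq_card hli, hs]
  have hfd : FiniteDimensional ℂ (Submodule.span ℂ (s : Set H)) :=
    FiniteDimensional.span_finset ℂ s
  let b := (stdOrthonormalBasis ℂ (Submodule.span ℂ (s : Set H))).reindex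
    (Fintype.equivOfCardEq (by simp [hfr]) : _ ≃ κ)
  exact ⟨_, b.orthonormal.comp_linearIsometry (Submodule.subtypeₗᵢ _)⟩

end OrthogonalRanges

/-! ### Spectral resolutions of matrices and the proof of (1). -/

section Matrices

open Matrix

variable {n : ℕ}

lemma toEuclideanCLM_mem_sp_iff {J : Set ℝ} {A : Matrix (Fin n) (Fin n) ℂ} :
    toEuclideanCLM (n := Fin n) (𝕜 := ℂ) A ∈
      sp (EuclideanSpace ℂ (Fin n) →L[ℂ] EuclideanSpace ℂ (Fin n)) J ↔
    A ∈ sp (Matrix (Fin n) (Fin n) ℂ) J := by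
  have h1 : IsSelfAdjoint (toEuclideanCLM (n := Fin n) (𝕜 := ℂ) A) ↔ IsSelfAdjoint A := by
    rw [isSelfAdjoint_iff, isSelfAdjoint_iff, ← map_star, EmbeddingLike.apply_eq_iff_eq]
  have h2 : spectrum ℝ (toEuclideanCLM (n := Fin n) (𝕜 := ℂ) A) = spectrum ℝ A :=
    AlgEquiv.spectrum_eq ((toEuclideanCLM (n := Fin n) (𝕜 := ℂ)).toAlgEquiv.restrictScalars ℝ) A
  simp only [sp, Set.mem_ofPred_eq, h1, h2]

lemma toEuclideanCLM_cfc (f : ℝ → ℝ) {A : Matrix (Fin n) (Fin n) ℂ} (hA : IsSelfAdjoint A) :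
    toEuclideanCLM (n := Fin n) (𝕜 := ℂ) (cfc f A) =
      cfc f (toEuclideanCLM (n := Fin n) (𝕜 := ℂ) A) :=
  StarAlgHomClass.map_cfc (S := ℂ) (toEuclideanCLM (n := Fin n) (𝕜 := ℂ)) f A
    (A.finite_real_spectrum.continuousOn f)
    (LinearMap.continuous_of_finiteDimensional
      (toEuclideanCLM (n := Fin n) (𝕜 := ℂ)).toAlgEquiv.toLinearMap)
    hA (hA.map _)

/-- The spectral resolution of a self-adjoint matrix. -/
lemma exists_spectral_resolution {X : Matrix (Fin n) (Fin n) ℂ} (hX : IsSelfAdjoint X) :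
    ∃ (t : Fin n → ℝ) (P : Fin n → Matrix (Fin n) (Fin n) ℂ), (∀ k, t k ∈ spectrum ℝ X) ∧
      (∀ k, 0 ≤ P k) ∧ ∑ k, P k = 1 ∧ ∀ f : ℝ → ℝ, cfc f X = ∑ k, (f (t k) : ℂ) • P k := by
  have hX' : X.IsHermitian := hX
  let φ := Unitary.conjStarAlgAut ℂ (Matrix (Fin n) (Fin n) ℂ) hX'.eigenvectorUnitary
  have hcfc (f : ℝ → ℝ) : cfc f X = ∑ k, (f (hX'.eigenvalues k) : ℂ) • φ (single k k 1) := by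
    rw [hX'.cfc_eq, IsHermitian.cfc]
    simp only [← map_smul, ← map_sum]
    congr 1
    ext i j
    simp [Matrix.sum_apply, diagonal_apply, single_apply]
    split_ifs with hij
    · simp [hij]
    · exact (Finset.sum_eq_zero fun c _ => if_neg fun hc => hij (hc.1.symm.trans hc.2)).symm
  refine ⟨hX'.eigenvalues, fun k => φ (single k k 1), hX'.eigenvalues_mem_spectrum_real,
    fun k => ?_, ?_, hcfc⟩
  · have : φ (single k k 1) = star (φ (single k k 1)) * φ (single k k 1) := by
      rw [← map_star, ← map_mul]
      simp [star_eq_conjTranspose]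
    exact this.ge.trans' (star_mul_self_nonneg _)
  · have := hcfc (fun _ => 1)
    rw [cfc_const (1 : ℝ) X] at this
    simpa using this.symm

theorem choiDavisJensen_of_orthonormal {H : Type u} [NormedAddCommGroup H]
    [InnerProductSpace ℂ H] [CompleteSpace H] {J : Set ℝ} (hJ : J.OrdConnected) {f : ℝ → ℝ}
    (hf : ContinuousOn f J) (h : IsOperatorConvexOnSpace H J f) {m : ℕ}
    {e : (Fin m × Fin n) × Fin n → H} (he : Orthonormal ℂ e)
    {Φ : Fin m → (Matrix (Fin n) (Fin n) ℂ →ₚ[ℂ] Matrix (Fin n) (Fin n) ℂ)}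
    (hΦ : IsUnitalFamily Φ) {X : Fin m → Matrix (Fin n) (Fin n) ℂ}
    (hX : ∀ i, X i ∈ sp (Matrix (Fin n) (Fin n) ℂ) J) :
    cfc f (∑ i, Φ i (X i)) ≤ ∑ i, Φ i (cfc f (X i)) := by
  rcases n.eq_zero_or_pos with rfl | hn
  · exact (Subsingleton.elim _ _).le
  rcases m.eq_zero_or_pos with rfl | hm
  -- An empty family cannot be unital when `n > 0`.
  · have : Nonempty (Fin n) := ⟨⟨0, hn⟩⟩
    simp [IsUnitalFamily] at hΦ
  have : Nonempty (Fin m × Fin n) := ⟨(⟨0, hm⟩, ⟨0, hn⟩)⟩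
  choose t P ht hP hP1 hcfc using fun i => exists_spectral_resolution (hX i).1
  let ψ := toEuclideanCLM (n := Fin n) (𝕜 := ℂ)
  have hsmul (r : ℝ) (T : EuclideanSpace ℂ (Fin n) →L[ℂ] EuclideanSpace ℂ (Fin n)) :
      (r : ℂ) • T = r • T := by
    ext; simp
  have hsum (g : ℝ → ℝ) : ψ (∑ i, Φ i (cfc g (X i))) =
      ∑ p : Fin m × Fin n, g (t p.1 p.2) • ψ (Φ p.1 (P p.1 p.2)) := by
    simp only [hcfc, map_sum, map_smul, Fintype.sum_prod_type]
    simp only [hsmul]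
  have hid : ψ (∑ i, Φ i (X i)) =
      ∑ p : Fin m × Fin n, t p.1 p.2 • ψ (Φ p.1 (P p.1 p.2)) := by
    have := hsum id
    simpa only [fun i => cfc_id ℝ (X i) (hX i).1, id] using this
  obtain ⟨W, hW⟩ := exists_isometries_of_orthonormal he
  have hΦP (p : Fin m × Fin n) : 0 ≤ Φ p.1 (P p.1 p.2) := by
    simpa using OrderHomClass.mono (Φ p.1) (hP p.1 p.2)
  have key := h.cfc_sum_smul_le hJ hf hW (A := fun p => ψ (Φ p.1 (P p.1 p.2)))
    (t := fun p => t p.1 p.2)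
    (fun p => by simpa using (map_le_map_iff ψ).2 (hΦP p))
    (by
      rw [Fintype.sum_prod_type]
      simp only [← map_sum, hP1]
      rw [hΦ, map_one])
    (fun p => (hX p.1).2 (ht p.1 p.2))
  have hsa : IsSelfAdjoint (∑ i, Φ i (X i)) := by
    have : ∑ i, Φ i (X i) = ∑ p : Fin m × Fin n, t p.1 p.2 • Φ p.1 (P p.1 p.2) := by
      apply EquivLike.injective ψ
      rw [hid]
      simp only [map_sum, ← Complex.coe_smul, map_smul]
      simp only [hsmul]
    rw [this]
    exact isSelfAdjoint_sum _ fun p _ => (IsSelfAdjoint.all _).smul (hΦP p).isSelfAdjoint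
  rw [← map_le_map_iff ψ, hsum, toEuclideanCLM_cfc f hsa]
  rwa [← hid] at key

end Matrices

/-! ### From (1) to operator convexity. -/

section Converse

open ContinuousLinearMap
open Matrix (toEuclideanCLM cons_val_zero cons_val_one)
open scoped InnerProduct Polynomial
open Polynomial (aeval aeval_eq_sum_range)

lemma ChoiDavisJensen.isOperatorConvexOnSpace_euclideanSpace {J : Set ℝ} {f : ℝ → ℝ}
    (h : ChoiDavisJensen J f) (n : ℕ) :
    IsOperatorConvexOnSpace (EuclideanSpace ℂ (Fin n)) J f := by
  intro S hS T hT
  let ψ := toEuclideanCLM (n := Fin n) (𝕜 := ℂ)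
  obtain ⟨A, rfl⟩ : ∃ A, ψ A = S := EquivLike.surjective ψ S
  obtain ⟨B, rfl⟩ : ∃ B, ψ B = T := EquivLike.surjective ψ T
  rw [toEuclideanCLM_mem_sp_iff] at hS hT
  let Φ : Matrix (Fin n) (Fin n) ℂ →ₚ[ℂ] Matrix (Fin n) (Fin n) ℂ :=
    PositiveLinearMap.mk₀ ((1 / 2 : ℂ) • LinearMap.id) fun x hx => by
      have : (0 : ℂ) ≤ 1 / 2 := by
        rw [Complex.le_def]; norm_num
      exact smul_nonneg this hx
  have hΦ (x) : Φ x = (1 / 2 : ℂ) • x := rfl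
  have key := h n 2 (fun _ => Φ) (by
    simp only [IsUnitalFamily, hΦ, Fin.sum_univ_two, ← add_smul]; norm_num) ![A, B]
    (by intro i; fin_cases i <;> simpa)
  simp only [hΦ, Fin.sum_univ_two, cons_val_zero, cons_val_one] at key
  rw [← map_le_map_iff ψ, toEuclideanCLM_cfc f] at key
  · simp only [map_add, map_smul] at key
    rw [toEuclideanCLM_cfc f hS.1, toEuclideanCLM_cfc f hT.1] at key
    have e (Z : EuclideanSpace ℂ (Fin n) →L[ℂ] EuclideanSpace ℂ (Fin n)) :
        (1 / 2 : ℝ) • Z = (1 / 2 : ℂ) • Z := by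
      ext; simp
    simpa only [e, smul_add] using key
  · have hc : IsSelfAdjoint (1 / 2 : ℂ) := by simp [isSelfAdjoint_iff]
    exact (hc.smul hS.1).add (hc.smul hT.1)

variable {H : Type*} [NormedAddCommGroup H] [InnerProductSpace ℂ H] [CompleteSpace H]

lemma exists_isometry_range_of_finset (s : Finset H) :
    ∃ (n : ℕ) (V : EuclideanSpace ℂ (Fin n) →L[ℂ] H), V† ∘L V = 1 ∧ ∀ x ∈ s, ∃ y, V y = x := by
  have : FiniteDimensional ℂ (Submodule.span ℂ (s : Set H)) := FiniteDimensional.span_finset ℂ s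
  let b := stdOrthonormalBasis ℂ (Submodule.span ℂ (s : Set H))
  let L := (Submodule.subtypeₗᵢ (Submodule.span ℂ (s : Set H))).comp b.repr.symm.toLinearIsometry
  refine ⟨_, L.toContinuousLinearMap, ?_, fun x hx => ?_⟩
  · ext1 x
    refine ext_inner_left ℂ fun y => ?_
    rw [comp_apply, adjoint_inner_right]
    exact L.inner_map_map y x
  · exact ⟨b.repr ⟨x, Submodule.subset_span hx⟩, by simp [L]⟩

/-- `V V†` fixes the range of `V`, so compressing loses nothing while the iterates stay there. -/
lemma pow_apply_of_mem_range {K : Type*} [NormedAddCommGroup K] [InnerProductSpace ℂ K]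
    [CompleteSpace K] {V : K →L[ℂ] H} (hV : V† ∘L V = 1) {T : H →L[ℂ] H} {v : K} {N : ℕ}
    (hT : ∀ j ≤ N, ∃ y, V y = (T ^ j) (V v)) {j : ℕ} (hj : j ≤ N) :
    V (((V† ∘L T ∘L V) ^ j) v) = (T ^ j) (V v) := by
  have hVV (x : K) : (V†) (V x) = x := congr($hV x)
  induction j with
  | zero => simp
  | succ j ih =>
    obtain ⟨y, hy⟩ := hT _ hj
    rw [pow_succ', mul_def, comp_apply, comp_apply, comp_apply, ih (by omega), pow_succ', mul_def,
      comp_apply]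
    rw [pow_succ', mul_def, comp_apply] at hy
    rw [← hy, hVV]

lemma aeval_apply_of_mem_range {K : Type*} [NormedAddCommGroup K] [InnerProductSpace ℂ K]
    [CompleteSpace K] {V : K →L[ℂ] H} (hV : V† ∘L V = 1) {T : H →L[ℂ] H} {v : K} {p : ℝ[X]}
    (hT : ∀ j ≤ p.natDegree, ∃ y, V y = (T ^ j) (V v)) :
    V (aeval (V† ∘L T ∘L V) p v) = aeval T p (V v) := by
  simp only [aeval_eq_sum_range, sum_apply, smul_apply, map_sum, map_smul_of_tower]
  refine Finset.sum_congr rfl fun j hj => ?_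
  rw [pow_apply_of_mem_range hV hT (Finset.mem_range_succ_iff.1 hj)]

lemma abs_reApplyInnerSelf_le {K : Type*} [NormedAddCommGroup K] [InnerProductSpace ℂ K]
    {A : K →L[ℂ] K} {ε : ℝ} (x : K) (hA : ‖A‖ ≤ ε) :
    |A.reApplyInnerSelf x| ≤ ε * ‖x‖ ^ 2 := by
  rw [reApplyInnerSelf_apply]
  calc _ ≤ ‖inner ℂ (A x) x‖ := RCLike.abs_re_le_norm _
    _ ≤ ‖A x‖ * ‖x‖ := norm_inner_le_norm _ _
    _ ≤ (ε * ‖x‖) * ‖x‖ := by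
      gcongr
      exact (A.le_opNorm x).trans (by gcongr)
    _ = ε * ‖x‖ ^ 2 := by ring

lemma reApplyInnerSelf_half_smul_add_sub {K : Type*} [NormedAddCommGroup K]
    [InnerProductSpace ℂ K] (A B C : K →L[ℂ] K) (x : K) :
    ((1 / 2 : ℝ) • (A + B) - C).reApplyInnerSelf x =
      1 / 2 * (A.reApplyInnerSelf x + B.reApplyInnerSelf x) - C.reApplyInnerSelf x := by
  simp only [reApplyInnerSelf_apply, sub_apply, smul_apply, add_apply, inner_sub_left,
    RCLike.real_smul_eq_coe_smul (K := ℂ), inner_smul_left, inner_add_left, map_sub,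
    RCLike.conj_ofReal, RCLike.re_ofReal_mul, map_add]

/-- The quadratic forms of `f(T)` and of `f` of a compression of `T` are close at vectors whose
Krylov space lies in the range of the compression. -/
lemma abs_reApplyInnerSelf_cfc_sub_le {K : Type*} [NormedAddCommGroup K] [InnerProductSpace ℂ K]
    [CompleteSpace K] {V : K →L[ℂ] H} (hV : V† ∘L V = 1) {c d ε : ℝ} (hε : 0 ≤ ε) {f : ℝ → ℝ}
    (hf : ContinuousOn f (Set.Icc c d)) {p : ℝ[X]} (hp : ∀ x ∈ Set.Icc c d, |p.eval x - f x| < ε)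
    {T : H →L[ℂ] H} (hTmem : T ∈ sp (H →L[ℂ] H) (Set.Icc c d)) {v : K}
    (hT : ∀ j ≤ p.natDegree, ∃ y, V y = (T ^ j) (V v)) :
    |(cfc f T).reApplyInnerSelf (V v) - (cfc f (V† ∘L T ∘L V)).reApplyInnerSelf v|
      ≤ 2 * ε * ‖v‖ ^ 2 := by
  have hnorm : ‖V v‖ = ‖v‖ := by
    rw [← sq_eq_sq₀ (norm_nonneg _) (norm_nonneg _), ← inner_self_eq_norm_sq (𝕜 := ℂ) (V v),
      ← inner_self_eq_norm_sq (𝕜 := ℂ) v, ← adjoint_inner_right]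
    exact congrArg (fun z => RCLike.re (inner ℂ v z)) (congr($hV v))
  have h1 := abs_reApplyInnerSelf_le (V v) (norm_cfc_sub_aeval_le hε hf hp hTmem)
  have h2 := abs_reApplyInnerSelf_le v
    (norm_cfc_sub_aeval_le hε hf hp (adjoint_conj_mem_sp_Icc hV hTmem))
  have h3 : (aeval T p).reApplyInnerSelf (V v) =
      (aeval (V† ∘L T ∘L V) p).reApplyInnerSelf v := by
    rw [reApplyInnerSelf_apply, reApplyInnerSelf_apply, ← aeval_apply_of_mem_range hV hT,
      ← adjoint_inner_right]
    exact congrArg (fun z => RCLike.re (inner ℂ _ z)) (congr($hV v))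
  rw [hnorm] at h1
  simp only [reApplyInnerSelf_apply, sub_apply, inner_sub_left, map_sub] at h1 h2 h3 ⊢
  rw [h3] at h1
  rw [abs_le] at *
  constructor <;> linarith [h1.1, h1.2, h2.1, h2.2]

theorem ChoiDavisJensen.isOperatorConvexOnSpace {J : Set ℝ} (hJ : J.OrdConnected) {f : ℝ → ℝ}
    (hf : ContinuousOn f J) (h : ChoiDavisJensen J f) : IsOperatorConvexOnSpace H J f := by
  intro X hX Y hY
  cases subsingleton_or_nontrivial H
  · exact (Subsingleton.elim _ _).le
  obtain ⟨c₁, hc₁, d₁, hd₁, hX'⟩ := exists_mem_sp_Icc hX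
  obtain ⟨c₂, hc₂, d₂, hd₂, hY'⟩ := exists_mem_sp_Icc hY
  have hcd : Set.Icc (min c₁ c₂) (max d₁ d₂) ⊆ J :=
    hJ.out (by rcases min_choice c₁ c₂ with h | h <;> rwa [h])
      (by rcases max_choice d₁ d₂ with h | h <;> rwa [h])
  replace hX := sp_mono (Set.Icc_subset_Icc (min_le_left c₁ c₂) (le_max_left d₁ d₂)) hX'
  replace hY := sp_mono (Set.Icc_subset_Icc (min_le_right c₁ c₂) (le_max_right d₁ d₂)) hY'
  set c := min c₁ c₂
  set d := max d₁ d₂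
  have hZ := midpoint_mem_sp_Icc hX hY
  set Z := (1 / 2 : ℝ) • (X + Y) with hZdef
  have hsa : IsSelfAdjoint ((1 / 2 : ℝ) • (cfc f X + cfc f Y)) :=
    (IsSelfAdjoint.all _).smul ((cfc_predicate f X).add (cfc_predicate f Y))
  rw [le_def, isPositive_def]
  refine ⟨isSelfAdjoint_iff_isSymmetric.1 (hsa.sub (cfc_predicate f Z)), fun v => ?_⟩
  refine le_of_forall_pos_le_add fun ε hε => ?_
  -- Each quadratic form then moves by at most `ε / 2`; with weights `1/2`, `1/2`, `1` the total
  -- error is `ε`.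
  obtain ⟨p, hp⟩ := exists_polynomial_near_of_continuousOn c d f (hf.mono hcd)
    (ε / (4 * (‖v‖ ^ 2 + 1))) (by positivity)
  classical
  obtain ⟨n, V, hV, hr⟩ := exists_isometry_range_of_finset
    ((Finset.range (p.natDegree + 1)).biUnion fun j => {(X ^ j) v, (Y ^ j) v, (Z ^ j) v})
  have hr' (j : ℕ) (hj : j ≤ p.natDegree) : (∃ y, V y = (X ^ j) v) ∧ (∃ y, V y = (Y ^ j) v) ∧
      (∃ y, V y = (Z ^ j) v) := by
    have hj' := Finset.mem_range_succ_iff.2 hj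
    refine ⟨hr _ ?_, hr _ ?_, hr _ ?_⟩ <;> exact Finset.mem_biUnion.2 ⟨j, hj', by simp⟩
  -- The power `j = 0` puts `v` itself in the range.
  obtain ⟨w, rfl⟩ : ∃ w, V w = v := by simpa using (hr' 0 (Nat.zero_le _)).1
  have hε' : 0 ≤ ε / (4 * (‖V w‖ ^ 2 + 1)) := by positivity
  have bX := abs_reApplyInnerSelf_cfc_sub_le hV hε' (hf.mono hcd) hp hX fun j hj => (hr' j hj).1
  have bY := abs_reApplyInnerSelf_cfc_sub_le hV hε' (hf.mono hcd) hp hY fun j hj => (hr' j hj).2.1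
  have bZ := abs_reApplyInnerSelf_cfc_sub_le hV hε' (hf.mono hcd) hp hZ fun j hj => (hr' j hj).2.2
  have hmid := h.isOperatorConvexOnSpace_euclideanSpace n
    (V† ∘L X ∘L V) (sp_mono hcd (adjoint_conj_mem_sp_Icc hV hX))
    (V† ∘L Y ∘L V) (sp_mono hcd (adjoint_conj_mem_sp_Icc hV hY))
  have hZV : (1 / 2 : ℝ) • (V† ∘L X ∘L V + V† ∘L Y ∘L V) = V† ∘L Z ∘L V := by
    ext x
    simp [hZdef]
  rw [hZV, le_def, isPositive_def] at hmid
  have hw := hmid.2 w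
  have hnorm : ‖w‖ ^ 2 ≤ ‖V w‖ ^ 2 + 1 := by
    rw [← inner_self_eq_norm_sq (𝕜 := ℂ) (V w), ← inner_self_eq_norm_sq (𝕜 := ℂ) w,
      ← adjoint_inner_right, show (V†) (V w) = w from congr($hV w)]
    linarith
  have hb : 2 * (ε / (4 * (‖V w‖ ^ 2 + 1))) * ‖w‖ ^ 2 ≤ ε / 2 := by
    calc _ ≤ 2 * (ε / (4 * (‖V w‖ ^ 2 + 1))) * (‖V w‖ ^ 2 + 1) := by gcongr
      _ = ε / 2 := by field_simp; ring
  rw [reApplyInnerSelf_half_smul_add_sub] at hw ⊢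
  rw [abs_le] at bX bY bZ
  linarith [bX.1, bX.2, bY.1, bY.2, bZ.1, bZ.2]

end Converse

theorem mainTheorem5 (J : Set ℝ) (hJ : J.OrdConnected) (f : ℝ → ℝ) (hf : ContinuousOn f J) :
    (IsOperatorConvex.{u} J f ↔ ChoiDavisJensen J f) ∧
    ∀ (H : Type u) [NormedAddCommGroup H] [InnerProductSpace ℂ H] [CompleteSpace H],
      ¬ FiniteDimensional ℂ H → (IsOperatorConvexOnSpace H J f ↔ ChoiDavisJensen J f) := by
  refine ⟨⟨fun h n m Φ hΦ X hX => ?_, fun h H _ _ _ => h.isOperatorConvexOnSpace hJ hf⟩,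
    fun H _ _ _ hH => ⟨fun h n m Φ hΦ X hX => ?_, fun h => h.isOperatorConvexOnSpace hJ hf⟩⟩
  -- `ULift` places the finite-dimensional test space in universe `u`.
  · let κ := ULift.{u} ((Fin m × Fin n) × Fin n)
    have he := (EuclideanSpace.basisFun κ ℂ).orthonormal.comp ULift.up ULift.up_injective
    exact choiDavisJensen_of_orthonormal hJ hf (h (EuclideanSpace ℂ κ)) he hΦ hX
  · obtain ⟨e, he⟩ :=
      exists_orthonormal_of_not_finiteDimensional hH ((Fin m × Fin n) × Fin n)
    exact choiDavisJensen_of_orthonormal hJ hf h he hΦ hX
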